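/- Let $I$ be a finite index set. An *E-generalized Cartan matrix* (E-GCM) is a real matrix $A=(a_{ij})_{i,j\in I}$ such that $a_{ii}=2$ for all $i$, $a_{ij}\le 0$ for $i\ne j$, $a_{ij}\neq 0$ implies $a_{ji}\ne 0$, and for all $i\ne j$ either $a_{ij}a_{ji}\ge 4$ or $a_{ij}a_{ji}=4\cos^2(\pi/k)$ for some integer $k\ge 2$. For $i\neq j$ put $m_{ij}=k$ in the latter case and $m_{ij}=\infty$ in the former. Let $\Gamma$ be the graph with node set $I$ in which $i\ne j$ are adjacent if and only if $a_{ij}$ and $a_{ji}$ are nonzero. Let $W$ be the Coxeter group with generators $s_i$ ($i\in I$) and relations $s_i^2=1$ and $(s_is_j)^{m_{ij}}=1$ for $i\neq j$ (no relation if $m_{ij}=\infty$). Let $V$ be the real vector space with basis $(\alpha_i)_{i\in I}$, with the bilinear form $B$ given by $B(\alpha_i,\alpha_j)=\tfrac12 a_{ij}$. Then $W$ acts linearly on $V$ by $s_i.v=v-2B(\alpha_i,v)\alpha_i$, and on the dual space $V^*$ by $\langle w.\lambda,v\rangle=\langle\lambda,w^{-1}.v\rangle$. Let $D=\{\lambda\in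 V^*:\langle\lambda,\alpha_i\rangle\ge 0\text{ for all } i\in I\}$; the *Tits cone* is $U=\bigcup_{w\in W}wD\subseteq V^*$. Nodes $i\ne j$ are *odd neighbors* if $m_{ij}$ is finite and odd; in this case put $K_{ji}=\dfrac{-a_{ji}}{2\cos(\pi/m_{ij})}$. An *ON-cycle* is a sequence of nodes $[i_0,i_1,\dots,i_p]$, $p\ge 0$, with $i_p=i_0$ in which consecutive nodes are odd neighbors. The pair $(\Gamma,A)$ is *unital ON-cyclic* if $K_{i_pi_{p-1}}\cdots K_{i_2i_1}K_{i_1i_0}=1$ for every ON-cycle $[i_0,\dots,i_p]$ (the empty product being $1$). **Proposition 4.3.** Suppose that $\Gamma$ is connected, that $(\Gamma,A)$ is unital ON-cyclic, and that $W$ is infinite. Then $U$ is a convex cone, and the maximal linear subspace $U_0$ contained in $U$ is $\{0\}$; that is, $U\cap(-U)=\{0\}$, so $U$ is a strictly convex cone. -/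

import Mathlib

/-- An *E-generalized Cartan matrix* (E-GCM) with index set `ι`. -/
structure EGCM (ι : Type*) where
  /-- The underlying real matrix `(a_{ij})`. -/
  a : Matrix ι ι ℝ
  diag : ∀ i, a i i = 2
  nonpos : ∀ i j, i ≠ j → a i j ≤ 0
  ne_zero_symm : ∀ i j, a i j ≠ 0 → a j i ≠ 0
  product : ∀ i j, i ≠ j →
    4 ≤ a i j * a j i ∨
      ∃ k : ℕ, 2 ≤ k ∧ a i j * a j i = 4 * Real.cos (Real.pi / k) ^ 2

namespace EGCM

/-- The graph `Γ` of an E-GCM: an edge joins `i ≠ j` iff `a_{ij}` and `a_{ji}` are nonzero. -/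
def graph {ι : Type*} (A : EGCM ι) : SimpleGraph ι where
  Adj i j := i ≠ j ∧ A.a i j ≠ 0 ∧ A.a j i ≠ 0
  symm := ⟨fun _ _ h => ⟨h.1.symm, h.2.2, h.2.1⟩⟩
  loopless := ⟨fun _ h => h.1 rfl⟩

/-- The integers `k ≥ 2` with `a_{ij} a_{ji} = 4 cos² (π / k)`. There is at most one of them,
and there is none when `a_{ij} a_{ji} ≥ 4`. -/
def orderSet {ι : Type*} (A : EGCM ι) (i j : ι) : Set ℕ :=
  {k | 2 ≤ k ∧ A.a i j * A.a j i = 4 * Real.cos (Real.pi / k) ^ 2}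

/-- The numbers `m_{ij}`: for `i ≠ j` this is the `k ≥ 2` with `a_{ij} a_{ji} = 4 cos² (π / k)` if
there is one, and `∞` if `a_{ij} a_{ji} ≥ 4`. As in Mathlib's `CoxeterMatrix`, the value `∞`
is encoded by `0`, which is the value of `sInf` at the empty set of natural numbers. -/
noncomputable def m {ι : Type*} [DecidableEq ι] (A : EGCM ι) (i j : ι) : ℕ :=
  if i = j then 1 else sInf (A.orderSet i j)

theorem m_self {ι : Type*} [DecidableEq ι] (A : EGCM ι) (i : ι) : A.m i i = 1 := by
  simp [m]

theorem m_symm {ι : Type*} [DecidableEq ι] (A : EGCM ι) (i j : ι) : A.m i j = A.m j i := by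
  unfold m orderSet
  simp only [mul_comm (A.a i j), eq_comm (a := i)]

theorem m_eq_zero_or_mem {ι : Type*} [DecidableEq ι] (A : EGCM ι) {i j : ι} (hij : i ≠ j) :
    A.m i j = 0 ∨ A.m i j ∈ A.orderSet i j := by
  rw [m, if_neg hij]
  rcases Set.eq_empty_or_nonempty (A.orderSet i j) with h | h
  · left; simp [h]
  · right; exact Nat.sInf_mem h

/-- The Coxeter matrix `(m_{ij})`. -/
noncomputable def coxeterMatrix {ι : Type*} [DecidableEq ι] (A : EGCM ι) : CoxeterMatrix ι where
  M := Matrix.of A.m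
  isSymm := by ext i j; exact A.m_symm j i
  diagonal i := A.m_self i
  off_diagonal i j hij := by
    change A.m i j ≠ 1
    rcases A.m_eq_zero_or_mem hij with h | h
    · omega
    · have := h.1
      omega

/-- The associated Coxeter group `W`. -/
abbrev W {ι : Type*} [DecidableEq ι] (A : EGCM ι) : Type _ := A.coxeterMatrix.Group

/-- The bilinear form `B` on `V = ℝ^ι` with `B (α_i, α_j) = a_{ij} / 2`. -/
noncomputable def form {ι : Type*} [Fintype ι] [DecidableEq ι] (A : EGCM ι) :
    LinearMap.BilinForm ℝ (ι → ℝ) :=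
  Matrix.toBilin' ((1 / 2 : ℝ) • A.a)

/-- The simple root `α_i`, i.e. the `i`-th standard basis vector of `V = ℝ^ι`. -/
def simpleRoot {ι : Type*} [DecidableEq ι] (i : ι) : ι → ℝ := Pi.single i 1

/-- The operator `S_i v = v - 2 B(α_i, v) α_i`. -/
noncomputable def S {ι : Type*} [Fintype ι] [DecidableEq ι] (A : EGCM ι) (i : ι) :
    Module.End ℝ (ι → ℝ) :=
  LinearMap.id - ((2 : ℝ) • A.form (simpleRoot i)).smulRight (simpleRoot i)

theorem S_apply {ι : Type*} [Fintype ι] [DecidableEq ι] (A : EGCM ι) (i : ι) (v : ι → ℝ) :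
    A.S i v = v - (2 * A.form (simpleRoot i) v) • simpleRoot i := by
  simp [S]

theorem form_simpleRoot {ι : Type*} [Fintype ι] [DecidableEq ι] (A : EGCM ι) (i j : ι) :
    2 * A.form (simpleRoot i) (simpleRoot j) = A.a i j := by
  simp [form, simpleRoot]

/-- The operators `S_i` satisfy the defining relations of `W`. -/
theorem S_isLiftable {ι : Type*} [Fintype ι] [DecidableEq ι] (A : EGCM ι) :
    A.coxeterMatrix.IsLiftable A.S := by
  have hf (i : ι) : ((2 : ℝ) • A.form (simpleRoot i)) (simpleRoot i) = 2 := by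
    simpa [A.diag i] using A.form_simpleRoot i i
  have hS (i : ι) : A.S i = (Module.reflection (hf i)).toLinearMap := by
    refine LinearMap.ext fun v => ?_
    simp [S_apply, Module.reflection_apply]
  have hpow (i j : ι) (n : ℕ) : (A.S i * A.S j) ^ n =
      ((Module.reflection (hf i) * Module.reflection (hf j)) ^ n).toLinearMap := by
    induction n with
    | zero => rfl
    | succ n ih =>
      rw [pow_succ, ih, pow_succ, hS, hS]; rfl
  intro i j
  change (A.S i * A.S j) ^ A.m i j = 1
  rcases eq_or_ne i j with rfl | hij
  · rw [A.m_self, pow_one, hS]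
    refine LinearMap.ext fun v => ?_
    exact Module.involutive_reflection (hf i) v
  rcases A.m_eq_zero_or_mem hij with h | h
  · rw [h, pow_zero]
  generalize A.m i j = m at h
  obtain ⟨hm, hprod⟩ := h
  rw [hpow]
  apply LinearMap.ext
  intro z
  have hx : ((2 : ℝ) • A.form (simpleRoot i)) (simpleRoot j) = A.a i j := by
    simpa using A.form_simpleRoot i j
  have hy : ((2 : ℝ) • A.form (simpleRoot j)) (simpleRoot i) = A.a j i := by
    simpa using A.form_simpleRoot j i
  have ht : (2 * Real.cos (2 * Real.pi / m)) =
      ((2 : ℝ) • A.form (simpleRoot i)) (simpleRoot j) *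
        ((2 : ℝ) • A.form (simpleRoot j)) (simpleRoot i) - 2 := by
    rw [hx, hy, hprod, mul_div_assoc, Real.cos_two_mul]; ring
  have key := Module.reflection_mul_reflection_pow_apply (hf i) (hf j) m z _ ht
  refine key.trans ?_
  change _ = z
  rcases hm.eq_or_lt with rfl | hm
  · have h0 : A.a i j * A.a j i = 0 := by simp [hprod]
    have hij0 : A.a i j = 0 := by
      by_contra hne
      exact mul_ne_zero hne (A.ne_zero_symm i j hne) h0
    have hji0 : A.a j i = 0 := by
      by_contra hne
      exact A.ne_zero_symm j i hne hij0
    rw [hx, hy, hij0, hji0]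
    norm_num
    module
  have hm0 : (0 : ℝ) < m := by positivity
  have hm2 : (2 : ℝ) < m := by exact_mod_cast hm
  have hsin : Real.sin (2 * Real.pi / m) ≠ 0 := by
    apply ne_of_gt
    apply Real.sin_pos_of_pos_of_lt_pi
    · positivity
    · rw [div_lt_iff₀ hm0]; nlinarith [Real.pi_pos]
  have hC (n : ℤ) := Polynomial.Chebyshev.S_two_mul_real_cos (2 * Real.pi / m) n
  rcases Nat.even_or_odd' m with ⟨l, rfl | rfl⟩
  · have e1 : (((2 * l : ℕ) : ℤ) - 2) / 2 = (l : ℤ) - 1 := by omega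
    have e2 : (((2 * l : ℕ) : ℤ) - 1) / 2 = (l : ℤ) - 1 := by omega
    have hl : (0 : ℝ) < l := by push_cast at hm0; linarith
    have hz : (Polynomial.Chebyshev.S ℝ ((l : ℤ) - 1)).eval
        (2 * Real.cos (2 * Real.pi / (2 * l : ℕ))) = 0 := by
      apply (mul_eq_zero_iff_right hsin).mp
      rw [hC]
      have : ((((l : ℤ) - 1 : ℤ) : ℝ) + 1) * (2 * Real.pi / (2 * l : ℕ)) = Real.pi := by
        push_cast; field_simp; ring
      rw [this, Real.sin_pi]
    rw [e1, e2, hz]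
    simp
  · have e1 : (((2 * l + 1 : ℕ) : ℤ) - 1) / 2 = (l : ℤ) := by omega
    have e2 : (((2 * l + 1 : ℕ) : ℤ) - 2) / 2 = (l : ℤ) - 1 := by omega
    have e3 : (((2 * l + 1 : ℕ) : ℤ) - 3) / 2 = (l : ℤ) - 1 := by omega
    have e4 : (((2 * l + 1 : ℕ) : ℤ)) / 2 = (l : ℤ) := by omega
    have hz : (Polynomial.Chebyshev.S ℝ (l : ℤ)).eval
        (2 * Real.cos (2 * Real.pi / (2 * l + 1 : ℕ))) +
        (Polynomial.Chebyshev.S ℝ ((l : ℤ) - 1)).eval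
        (2 * Real.cos (2 * Real.pi / (2 * l + 1 : ℕ))) = 0 := by
      apply (mul_eq_zero_iff_right hsin).mp
      rw [add_mul, hC, hC]
      have : (((l : ℤ) : ℝ) + 1) * (2 * Real.pi / (2 * l + 1 : ℕ)) =
          2 * Real.pi - ((((l : ℤ) - 1 : ℤ) : ℝ) + 1) * (2 * Real.pi / (2 * l + 1 : ℕ)) := by
        push_cast; field_simp; ring
      rw [this, Real.sin_two_pi_sub]
      ring
    rw [e1, e2, e3, e4, hz]
    simp

/-- The geometric representation `σ` of `W` on `V = ℝ^ι`, determined by `σ(s_i) = S_i`. -/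
noncomputable def sigma {ι : Type*} [Fintype ι] [DecidableEq ι] (A : EGCM ι) :
    Representation ℝ A.W (ι → ℝ) :=
  A.coxeterMatrix.toCoxeterSystem.lift ⟨A.S, A.S_isLiftable⟩

theorem sigma_simple {ι : Type*} [Fintype ι] [DecidableEq ι] (A : EGCM ι) (i : ι) :
    A.sigma (A.coxeterMatrix.simple i) = A.S i :=
  A.coxeterMatrix.toCoxeterSystem.lift_apply_simple A.S_isLiftable i

/-- The set `D = {λ ∈ V* | ⟨λ, α_i⟩ ≥ 0 for all i}`. -/
def fundamentalChamber (ι : Type*) [DecidableEq ι] : Set (Module.Dual ℝ (ι → ℝ)) :=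
  {l | ∀ i, 0 ≤ l (simpleRoot i)}

/-- The Tits cone `U = ⋃_{w ∈ W} w D`, where `W` acts on `V*` by the contragredient
representation `⟨w.λ, v⟩ = ⟨λ, w⁻¹.v⟩`. -/
noncomputable def titsCone {ι : Type*} [Fintype ι] [DecidableEq ι] (A : EGCM ι) :
    Set (Module.Dual ℝ (ι → ℝ)) :=
  ⋃ w : A.W, A.sigma.dual w '' fundamentalChamber ι

/-- The graph of odd neighbors: `i ≠ j` are joined iff `m_{ij}` is odd (in particular finite).
ON-paths are the walks of this graph, and ON-cycles are its closed walks. -/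
def oddGraph {ι : Type*} [DecidableEq ι] (A : EGCM ι) : SimpleGraph ι where
  Adj i j := i ≠ j ∧ Odd (A.m i j)
  symm := ⟨fun i j h => ⟨h.1.symm, A.m_symm i j ▸ h.2⟩⟩
  loopless := ⟨fun _ h => h.1 rfl⟩

/-- The number `K_{ji} = -a_{ji} / (2 cos (π / m_{ij}))`, used for odd neighbors `i`, `j`. -/
noncomputable def K {ι : Type*} [DecidableEq ι] (A : EGCM ι) (j i : ι) : ℝ :=
  -A.a j i / (2 * Real.cos (Real.pi / A.m i j))

/-- The product `Π_P = K_{i_p i_{p-1}} ⋯ K_{i_2 i_1} K_{i_1 i_0}` over an ON-path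
`P = [i_0, i_1, …, i_p]`. -/
noncomputable def pathScalar {ι : Type*} [DecidableEq ι] (A : EGCM ι) :
    {i j : ι} → A.oddGraph.Walk i j → ℝ
  | _, _, .nil => 1
  | i, _, .cons (v := k) _ p => A.pathScalar p * A.K k i

/-- `(Γ, A)` is *unital ON-cyclic*: `Π_C = 1` for every ON-cycle `C`. -/
def UnitalONCyclic {ι : Type*} [DecidableEq ι] (A : EGCM ι) : Prop :=
  ∀ (i : ι) (C : A.oddGraph.Walk i i), A.pathScalar C = 1

end EGCM

/-! Roots are the vectors `w.α_i`. Splitting off a maximal dihedral suffix shows that every root is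
nonnegative or nonpositive, the sign being decided by whether `i` is a right descent of `w`
(`sigma_simpleRoot_nonneg`). Convexity of `U` follows by tracking where a segment leaves the chamber
(`add_mem_titsCone_of_mem_fundamentalChamber`).

For strictness, let `L = U ∩ (-U)`, a `W`-stable subspace. If `L` kills one root, its annihilator
contains a simple root, hence all of them by connectedness, and `L = 0`. Otherwise take a finite
spanning set `G` of `L` and, for `g ∈ G`, chambers containing `g` and `-g`. A positive root inverted
by none of the finitely many chamber elements would have `g ≥ 0` and `-g ≥ 0` on it, so `L` would
kill it. So every positive root is an inversion of one of finitely many elements. Inversions fill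
finitely many rays, and `W` acts faithfully on root rays, so `W` is finite. -/

namespace EGCM

open CoxeterSystem

/-! ### Dihedral suffixes in a Coxeter group -/

section Length

variable {B W : Type*} [Group W] {M : CoxeterMatrix B} (cs : CoxeterSystem M W)

/-- Split off a maximal alternating suffix in two letters `i`, `j` from an element that has `j`
but not `i` as a right descent. -/
theorem exists_eq_mul_alternatingWord {w : W} {i j : B} (hi : ¬ cs.IsRightDescent w i)
    (hj : cs.IsRightDescent w j) :
    ∃ (v : W) (q : ℕ), w = v * cs.wordProd (alternatingWord i j q) ∧
      cs.length v < cs.length w ∧ ¬ cs.IsRightDescent v i ∧ ¬ cs.IsRightDescent v j ∧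
      (M i j = 0 ∨ q < M i j) := by
  classical
  -- The lengths must add up; `q` is then bounded by the length of `w`, so a largest one exists.
  set P : ℕ → Prop := fun q => ∃ v : W, w = v * cs.wordProd (alternatingWord i j q) ∧
    cs.length w = cs.length v + q with hP
  have hbound : ∀ q, P q → q ≤ cs.length w := by
    rintro q ⟨v, -, h⟩; omega
  have h1 : P 1 := by
    refine ⟨w * cs.simple j, ?_, ?_⟩
    · simp [alternatingWord]
    · exact (cs.isRightDescent_iff.mp hj).symm
  obtain ⟨q, hq, hmax⟩ : ∃ q, P q ∧ ∀ k, P k → k ≤ q :=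
    ⟨Nat.findGreatest P (cs.length w), Nat.findGreatest_spec (hbound 1 h1) h1,
      fun k hk => Nat.le_findGreatest (hbound k hk) hk⟩
  have hq1 : 1 ≤ q := hmax 1 h1
  obtain ⟨v, hw, hl⟩ := hq
  -- This letter would extend the suffix, against maximality of `q`.
  have hnext : ¬ cs.IsRightDescent v (if Even q then j else i) := by
    intro hd
    have : P (q + 1) := by
      refine ⟨v * cs.simple (if Even q then j else i), ?_, ?_⟩
      · rw [alternatingWord_succ', wordProd_cons, ← mul_assoc, simple_mul_simple_cancel_right, hw]
      · have := cs.isRightDescent_iff.mp hd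
        omega
    have := hmax _ this
    omega
  -- This letter is the first one of the suffix; as a descent of `v` it would cancel and make `w`
  -- too short.
  have hprev : ¬ cs.IsRightDescent v (if Even q then i else j) := by
    intro hd
    obtain ⟨r, rfl⟩ : ∃ r, q = r + 1 := ⟨q - 1, by omega⟩
    have hc : (if Even (r + 1) then i else j) = if Even r then j else i := by
      by_cases hr : Even r
      · simp [hr, Nat.even_add_one]
      · simp [hr, Nat.even_add_one]
    rw [hc] at hd
    have hw' := hw
    rw [alternatingWord_succ', wordProd_cons, ← mul_assoc] at hw'
    have h2 := cs.length_mul_le (v * cs.simple (if Even r then j else i))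
      (cs.wordProd (alternatingWord i j r))
    rw [← hw'] at h2
    have h3 := cs.length_wordProd_le (alternatingWord i j r)
    rw [length_alternatingWord] at h3
    have := cs.isRightDescent_iff.mp hd
    omega
  refine ⟨v, q, hw, by omega, ?_, ?_, ?_⟩
  · by_cases h : Even q
    · simpa [h] using hprev
    · simpa [h] using hnext
  · by_cases h : Even q
    · simpa [h] using hnext
    · simpa [h] using hprev
  -- The suffix is reduced, so `q` would equal `M i j`; the braid relation then rewrites it to end
  -- in `i`, making `i` a right descent of `w`.
  · by_contra! hcon
    obtain ⟨hM0, hMq⟩ := hcon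
    have hred : cs.IsReduced (alternatingWord i j q) := by
      have h2 := cs.length_mul_le v (cs.wordProd (alternatingWord i j q))
      have h3 := cs.length_wordProd_le (alternatingWord i j q)
      rw [length_alternatingWord] at h3
      rw [← hw] at h2
      unfold CoxeterSystem.IsReduced
      rw [length_alternatingWord]
      omega
    have hqM : q = M i j := by
      by_contra hne
      exact cs.not_isReduced_alternatingWord i j hM0 (by omega) hred
    obtain ⟨r, hr⟩ : ∃ r, M i j = r + 1 := ⟨M i j - 1, by omega⟩
    have hb := cs.wordProd_braidWord_eq i j
    unfold CoxeterSystem.braidWord at hb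
    rw [M.symmetric j i, hr, alternatingWord_succ j i, List.concat_eq_append,
      wordProd_append] at hb
    rw [hqM, hr, hb] at hw
    apply hi
    have h2 := cs.length_mul_le v (cs.wordProd (alternatingWord i j r))
    have h3 := cs.length_wordProd_le (alternatingWord i j r)
    rw [length_alternatingWord] at h3
    have : w * cs.simple i = v * cs.wordProd (alternatingWord i j r) := by
      rw [hw]; simp [mul_assoc]
    unfold CoxeterSystem.IsRightDescent
    rw [this]
    omega

end Length

/-! ### Signs of Chebyshev values -/

section Recurrence

/-- The sequence `0, 1, x, x² - 1, …` of Chebyshev polynomials of the second kind at `x / 2`. -/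
def cheb (x : ℝ) : ℕ → ℝ
  | 0 => 0
  | 1 => 1
  | n + 2 => x * cheb x (n + 1) - cheb x n

theorem cheb_nonneg_of_two_le {x : ℝ} (hx : 2 ≤ x) (n : ℕ) : 0 ≤ cheb x n := by
  have h : ∀ n, 0 ≤ cheb x n ∧ cheb x n ≤ cheb x (n + 1) := by
    intro n
    induction n with
    | zero => simp [cheb]
    | succ n ih =>
      refine ⟨ih.1.trans ih.2, ?_⟩
      rw [show n + 1 + 1 = n + 2 from rfl, cheb]
      nlinarith [ih.1, ih.2]
  exact (h n).1

theorem sin_mul_cheb (θ : ℝ) (n : ℕ) :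
    Real.sin θ * cheb (2 * Real.cos θ) n = Real.sin (n * θ) := by
  have h : ∀ n : ℕ, Real.sin θ * cheb (2 * Real.cos θ) n = Real.sin (n * θ) ∧
      Real.sin θ * cheb (2 * Real.cos θ) (n + 1) = Real.sin ((n + 1 : ℕ) * θ) := by
    intro n
    induction n with
    | zero => simp [cheb]
    | succ n ih =>
      refine ⟨ih.2, ?_⟩
      rw [show n + 1 + 1 = n + 2 from rfl, cheb]
      have e1 : ((n + 2 : ℕ) : ℝ) * θ = ((n + 1 : ℕ) : ℝ) * θ + θ := by push_cast; ring
      have e2 : ((n : ℕ) : ℝ) * θ = ((n + 1 : ℕ) : ℝ) * θ - θ := by push_cast; ring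
      have h1 := ih.1
      have h2 := ih.2
      rw [e2, Real.sin_sub] at h1
      rw [e1, Real.sin_add]
      linear_combination 2 * Real.cos θ * h2 - h1
  exact (h n).1

/-- The value is `sin (nπ/m) / sin (π/m)`, and `nπ/m` stays in `[0, π]`. -/
theorem cheb_nonneg_of_le {m n : ℕ} (hm : 2 ≤ m) (hn : n ≤ m) :
    0 ≤ cheb (2 * Real.cos (Real.pi / m)) n := by
  have hm0 : (0 : ℝ) < m := by positivity
  have hm2 : (2 : ℝ) ≤ m := by exact_mod_cast hm
  have hsin : 0 < Real.sin (Real.pi / m) := by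
    apply Real.sin_pos_of_pos_of_lt_pi (by positivity)
    rw [div_lt_iff₀ hm0]
    nlinarith [Real.pi_pos]
  have h := sin_mul_cheb (Real.pi / m) n
  have hr : 0 ≤ Real.sin (n * (Real.pi / m)) := by
    apply Real.sin_nonneg_of_nonneg_of_le_pi (by positivity)
    rw [← mul_div_assoc, div_le_iff₀ hm0, mul_comm]
    have : (n : ℝ) ≤ m := by exact_mod_cast hn
    gcongr
  rw [← h] at hr
  exact nonneg_of_mul_nonneg_right hr hsin

end Recurrence

/-! ### Positive and negative roots -/

theorem simpleRoot_nonneg {ι : Type*} [DecidableEq ι] (i : ι) : (0 : ι → ℝ) ≤ simpleRoot i := by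
  intro k
  by_cases h : k = i
  · subst h; simp [simpleRoot]
  · simp [simpleRoot, h]

theorem simpleRoot_ne_zero {ι : Type*} [DecidableEq ι] (i : ι) : (simpleRoot i : ι → ℝ) ≠ 0 := by
  intro h
  have := congrFun h i
  simp [simpleRoot] at this

variable {ι : Type*} [Fintype ι] [DecidableEq ι] (A : EGCM ι)

/-- The Coxeter system of the Coxeter group attached to an E-GCM. -/
noncomputable abbrev cs : CoxeterSystem A.coxeterMatrix A.W := A.coxeterMatrix.toCoxeterSystem

theorem sigma_cs_simple (i : ι) : A.sigma (A.cs.simple i) = A.S i := A.sigma_simple i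

theorem S_simpleRoot (i j : ι) :
    A.S i (simpleRoot j) = simpleRoot j - A.a i j • simpleRoot i := by
  rw [S_apply, form_simpleRoot]

theorem S_simpleRoot_self (i : ι) : A.S i (simpleRoot i) = -simpleRoot i := by
  rw [S_simpleRoot, A.diag]
  module

theorem sigma_mul_apply (v w : A.W) (x : ι → ℝ) :
    A.sigma (v * w) x = A.sigma v (A.sigma w x) := by
  rw [map_mul]; rfl

theorem sigma_inv_apply_self (w : A.W) (x : ι → ℝ) : A.sigma w⁻¹ (A.sigma w x) = x := by
  rw [← sigma_mul_apply]; simp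

theorem sigma_self_apply_inv (w : A.W) (x : ι → ℝ) : A.sigma w (A.sigma w⁻¹ x) = x := by
  rw [← sigma_mul_apply]; simp

theorem S_S (i : ι) (x : ι → ℝ) : A.S i (A.S i x) = x := by
  have := A.sigma_inv_apply_self (A.cs.simple i) x
  rwa [A.cs.inv_simple, sigma_cs_simple] at this

/-- Rank two computation: the orbit of `α_i` under the dihedral subgroup of `s_i` and `s_j`. -/
theorem exists_sigma_alternatingWord {i j : ι} {x κ : ℝ} (hj : -A.a j i = x * κ)
    (hi : -A.a i j * κ = x) (q : ℕ) :
    A.sigma (A.cs.wordProd (alternatingWord i j q)) (simpleRoot i) =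
      (if Even q then cheb x (q + 1) else cheb x q) • simpleRoot i +
      (κ * if Even q then cheb x q else cheb x (q + 1)) • simpleRoot j := by
  induction q with
  | zero => simp [alternatingWord, cheb]
  | succ q ih =>
    rw [alternatingWord_succ', wordProd_cons, sigma_mul_apply, ih, sigma_cs_simple]
    by_cases hq : Even q
    · have hq' : ¬ Even (q + 1) := by simpa [Nat.even_add_one] using hq
      simp only [hq, hq', if_true, if_false, map_add, map_smul]
      rw [S_simpleRoot, S_simpleRoot_self, cheb]
      rw [← neg_neg (A.a j i), hj]
      module
    · have hq' : Even (q + 1) := by simpa [Nat.even_add_one] using hq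
      simp only [hq, hq', if_true, if_false, map_add, map_smul]
      rw [S_simpleRoot_self, S_simpleRoot, cheb]
      rw [← hi]
      module

/-- With `x² = a_{ij} a_{ji}`, the coefficients are Chebyshev values at `x`, of index at most `q +
1`, up to a positive rescaling. Either `x ≥ 2`, or `x = 2 cos (π/m)` with `q + 1 ≤ m`. -/
theorem exists_nonneg_sigma_alternatingWord {i j : ι} (hij : i ≠ j) {q : ℕ}
    (hq : A.m i j = 0 ∨ q < A.m i j) :
    ∃ c d : ℝ, 0 ≤ c ∧ 0 ≤ d ∧
      A.sigma (A.cs.wordProd (alternatingWord i j q)) (simpleRoot i) =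
        c • simpleRoot i + d • simpleRoot j := by
  have hai := A.nonpos i j hij
  have haj := A.nonpos j i hij.symm
  suffices h : A.a i j ≠ 0 → ∃ x : ℝ, 0 < x ∧ x * x = A.a i j * A.a j i ∧
      0 ≤ cheb x q ∧ 0 ≤ cheb x (q + 1) by
    -- Here `x = 0` could not be divided by; but `m = 2`, so only `q = 0, 1` occur.
    by_cases h0 : A.a i j = 0
    · have h0' : A.a j i = 0 := by
        by_contra hne
        exact A.ne_zero_symm j i hne h0
      have hm : A.m i j ≠ 0 ∧ A.m i j ≤ 2 := by
        have hmem : 2 ∈ A.orderSet i j := by simp [orderSet, h0]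
        have hle : A.m i j ≤ 2 := by
          rw [m, if_neg hij]; exact Nat.sInf_le hmem
        refine ⟨fun hm0 => ?_, hle⟩
        rw [m, if_neg hij] at hm0
        have := Nat.sInf_mem ⟨2, hmem⟩
        rw [hm0] at this
        exact absurd this.1 (by norm_num)
      have hq2 : q < 2 := by omega
      refine ⟨1, 0, zero_le_one, le_rfl, ?_⟩
      interval_cases q
      · simp [alternatingWord]
      · simp [alternatingWord, sigma_cs_simple, S_simpleRoot, h0',
          -CoxeterMatrix.toCoxeterSystem_simple]
    · obtain ⟨x, hx, hxx, h1, h2⟩ := h h0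
      -- `κ` rescales `α_j` to make up for the asymmetry of `A`.
      have hκ : 0 ≤ -A.a j i / x := div_nonneg (by linarith) hx.le
      refine ⟨_, _, ?_, ?_, A.exists_sigma_alternatingWord (x := x) (κ := -A.a j i / x) ?_ ?_ q⟩
      · split_ifs <;> assumption
      · split_ifs <;> positivity
      · field_simp
      · field_simp
        linarith
  intro h0
  have h0' := A.ne_zero_symm i j h0
  rcases A.m_eq_zero_or_mem hij with hm | hm
  · have hprod : 4 ≤ A.a i j * A.a j i := by
      rcases A.product i j hij with h | ⟨k, hk⟩
      · exact h
      · exfalso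
        rw [m, if_neg hij] at hm
        have := Nat.sInf_mem (s := A.orderSet i j) ⟨k, hk⟩
        rw [hm] at this
        exact absurd this.1 (by norm_num)
    have h2 : 2 ≤ Real.sqrt (A.a i j * A.a j i) := by
      apply Real.le_sqrt_of_sq_le; linarith
    exact ⟨Real.sqrt (A.a i j * A.a j i), by linarith,
      Real.mul_self_sqrt (by linarith), cheb_nonneg_of_two_le h2 _, cheb_nonneg_of_two_le h2 _⟩
  · obtain ⟨hm2, hprod⟩ := hm
    have hq' : q < A.m i j := by omega
    refine ⟨2 * Real.cos (Real.pi / A.m i j), ?_, ?_, cheb_nonneg_of_le hm2 hq'.le,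
      cheb_nonneg_of_le hm2 hq'⟩
    · have hmR : (2 : ℝ) ≤ A.m i j := by exact_mod_cast hm2
      have hc : 0 ≤ Real.cos (Real.pi / A.m i j) := by
        apply Real.cos_nonneg_of_neg_pi_div_two_le_of_le
        · have : 0 ≤ Real.pi / A.m i j := by positivity
          linarith [Real.pi_pos]
        · gcongr
      have hc0 : Real.cos (Real.pi / A.m i j) ≠ 0 := by
        intro hc0
        rw [hc0] at hprod
        exact mul_ne_zero h0 h0' (by simpa using hprod)
      positivity
    · rw [hprod]; ring

/-- Write `w = v u` with `u` a maximal alternating suffix: `u` sends `α_i` to a nonnegative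
combination of `α_i` and `α_j`, and induction on length applies to the shorter `v`, which has
neither descent. -/
theorem sigma_simpleRoot_nonneg (w : A.W) (i : ι) (h : ¬ A.cs.IsRightDescent w i) :
    0 ≤ A.sigma w (simpleRoot i) := by
  induction hn : A.cs.length w using Nat.strong_induction_on generalizing w i with
  | _ n ih =>
    by_cases hw : w = 1
    · subst hw
      simpa using simpleRoot_nonneg i
    obtain ⟨j, hj⟩ := A.cs.exists_rightDescent_of_ne_one hw
    have hij : i ≠ j := by rintro rfl; exact h hj
    obtain ⟨v, q, hwv, hlt, hvi, hvj, hq⟩ := exists_eq_mul_alternatingWord A.cs h hj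
    obtain ⟨c, d, hc, hd, he⟩ := A.exists_nonneg_sigma_alternatingWord hij hq
    rw [hwv, sigma_mul_apply, he, map_add, map_smul, map_smul]
    have h1 := ih _ (hn ▸ hlt) v i hvi rfl
    have h2 := ih _ (hn ▸ hlt) v j hvj rfl
    exact add_nonneg (smul_nonneg hc h1) (smul_nonneg hd h2)

theorem sigma_simpleRoot_nonpos (w : A.W) (i : ι) (h : A.cs.IsRightDescent w i) :
    A.sigma w (simpleRoot i) ≤ 0 := by
  have h1 := A.sigma_simpleRoot_nonneg (w * A.cs.simple i) i
    (A.cs.isRightDescent_iff_not_isRightDescent_mul.mp h)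
  rw [sigma_mul_apply, sigma_cs_simple, S_simpleRoot_self, map_neg] at h1
  exact neg_nonneg.mp h1

theorem sigma_simpleRoot_ne_zero (w : A.W) (i : ι) : A.sigma w (simpleRoot i) ≠ 0 := by
  intro h
  apply simpleRoot_ne_zero i
  rw [← A.sigma_inv_apply_self w (simpleRoot i), h, map_zero]

theorem sigma_simpleRoot_nonneg_or_nonpos (w : A.W) (i : ι) :
    0 ≤ A.sigma w (simpleRoot i) ∨ A.sigma w (simpleRoot i) ≤ 0 := by
  by_cases h : A.cs.IsRightDescent w i
  · exact .inr (A.sigma_simpleRoot_nonpos w i h)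
  · exact .inl (A.sigma_simpleRoot_nonneg w i h)

theorem eq_one_of_sigma_simpleRoot_nonneg {w : A.W} (h : ∀ i, 0 ≤ A.sigma w (simpleRoot i)) :
    w = 1 := by
  by_contra hw
  obtain ⟨j, hj⟩ := A.cs.exists_rightDescent_of_ne_one hw
  exact A.sigma_simpleRoot_ne_zero w j (le_antisymm (A.sigma_simpleRoot_nonpos w j hj) (h j))

/-! ### The Tits cone -/

theorem apply_nonneg_of_mem_fundamentalChamber {l : Module.Dual ℝ (ι → ℝ)}
    (hl : ∀ i, 0 ≤ l (simpleRoot i)) {v : ι → ℝ} (hv : 0 ≤ v) : 0 ≤ l v := by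
  have hsum : v = ∑ i, v i • (simpleRoot i : ι → ℝ) := by
    ext k
    simp [simpleRoot, Finset.sum_apply, Pi.single_apply]
  rw [hsum, map_sum]
  refine Finset.sum_nonneg fun i _ => ?_
  rw [map_smul]
  exact mul_nonneg (hv i) (hl i)

theorem mem_titsCone_iff {l : Module.Dual ℝ (ι → ℝ)} :
    l ∈ A.titsCone ↔ ∃ w : A.W, ∀ i, 0 ≤ l (A.sigma w (simpleRoot i)) := by
  simp only [titsCone, Set.mem_iUnion, Set.mem_image]
  refine exists_congr fun w => ?_
  constructor
  · rintro ⟨μ, hμ, rfl⟩ i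
    change 0 ≤ μ (A.sigma w⁻¹ (A.sigma w (simpleRoot i)))
    rw [sigma_inv_apply_self]
    exact hμ i
  · intro h
    refine ⟨l ∘ₗ A.sigma w, h, ?_⟩
    ext1
    ext
    change l (A.sigma w (A.sigma w⁻¹ _)) = l _
    rw [sigma_self_apply_inv]

theorem comp_sigma_mem_titsCone {l : Module.Dual ℝ (ι → ℝ)} (hl : l ∈ A.titsCone) (u : A.W) :
    l ∘ₗ A.sigma u ∈ A.titsCone := by
  rw [mem_titsCone_iff] at hl ⊢
  obtain ⟨w, hw⟩ := hl
  refine ⟨u⁻¹ * w, fun i => ?_⟩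
  rw [LinearMap.comp_apply, sigma_mul_apply, sigma_self_apply_inv]
  exact hw i

theorem comp_sigma_mem_titsCone_iff {l : Module.Dual ℝ (ι → ℝ)} {u : A.W} :
    l ∘ₗ A.sigma u ∈ A.titsCone ↔ l ∈ A.titsCone := by
  refine ⟨fun h => ?_, fun h => A.comp_sigma_mem_titsCone h u⟩
  have := A.comp_sigma_mem_titsCone h u⁻¹
  convert this using 1
  refine LinearMap.ext fun x => ?_
  simp only [LinearMap.comp_apply, sigma_self_apply_inv]

/-- The point where the segment from `l ∈ D` in direction `μ` leaves the chamber `D`. -/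
theorem exists_boundary_point {l μ : Module.Dual ℝ (ι → ℝ)} (hl : ∀ i, 0 ≤ l (simpleRoot i))
    (h : ¬ ∀ i, 0 ≤ (l + μ) (simpleRoot i)) :
    ∃ (t : ℝ) (i : ι), 0 ≤ t ∧ t < 1 ∧ μ (simpleRoot i) < 0 ∧ (l + t • μ) (simpleRoot i) = 0 ∧
      ∀ k, 0 ≤ (l + t • μ) (simpleRoot k) := by
  push Not at h
  obtain ⟨k, hk⟩ := h
  rw [LinearMap.add_apply] at hk
  have hkneg : μ (simpleRoot k) < 0 := by linarith [hl k]
  obtain ⟨i, hi, hmin⟩ := Finset.exists_min_image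
    (Finset.univ.filter fun i => μ (simpleRoot i) < 0)
    (fun i => l (simpleRoot i) / -μ (simpleRoot i)) ⟨k, by simpa using hkneg⟩
  have hineg : μ (simpleRoot i) < 0 := by simpa using hi
  refine ⟨l (simpleRoot i) / -μ (simpleRoot i), i, div_nonneg (hl i) (by linarith), ?_, hineg, ?_,
    fun j => ?_⟩
  · refine (hmin k (by simpa using hkneg)).trans_lt ?_
    rw [div_lt_one (by linarith)]
    linarith
  · have := hineg.ne
    simp only [LinearMap.add_apply, LinearMap.smul_apply, smul_eq_mul]
    field_simp
    ring
  · simp only [LinearMap.add_apply, LinearMap.smul_apply, smul_eq_mul]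
    by_cases hj : μ (simpleRoot j) < 0
    · have := hmin j (by simpa using hj)
      rw [le_div_iff₀ (by linarith)] at this
      linarith
    · have h1 : 0 ≤ l (simpleRoot i) / -μ (simpleRoot i) := div_nonneg (hl i) (by linarith)
      have := mul_nonneg h1 (not_lt.mp hj)
      linarith [hl j]

/-- Induction on the length of `w`. If `l + μ` is outside `D`, the path leaves `D` at `l + tμ`
through a wall `i`. Since `μ` is negative on `α_i`, `i` is a left descent of `w`. Reflecting in
`s_i` fixes `l + tμ` and moves the remainder `(1 - t)μ` to the chamber of the shorter `s_i w`. -/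
theorem add_mem_titsCone_of_mem_fundamentalChamber (w : A.W) {l μ : Module.Dual ℝ (ι → ℝ)}
    (hl : ∀ i, 0 ≤ l (simpleRoot i)) (hμ : ∀ i, 0 ≤ μ (A.sigma w (simpleRoot i))) :
    l + μ ∈ A.titsCone := by
  induction hn : A.cs.length w using Nat.strong_induction_on generalizing w l μ with
  | _ n ih =>
    by_cases h : ∀ i, 0 ≤ (l + μ) (simpleRoot i)
    · exact A.mem_titsCone_iff.mpr ⟨1, by simpa using h⟩
    obtain ⟨t, i, ht0, ht1, hi, hti, htD⟩ := exists_boundary_point hl h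
    have hdesc : A.cs.IsLeftDescent w i := by
      rw [← A.cs.isRightDescent_inv_iff]
      by_contra hnd
      have h1 := A.sigma_simpleRoot_nonneg _ _ hnd
      have h2 := apply_nonneg_of_mem_fundamentalChamber (l := μ ∘ₗ A.sigma w) hμ h1
      rw [LinearMap.comp_apply, sigma_self_apply_inv] at h2
      linarith
    have hfix : (l + t • μ) ∘ₗ A.sigma (A.cs.simple i) = l + t • μ := by
      refine LinearMap.ext fun x => ?_
      rw [LinearMap.comp_apply, sigma_cs_simple, S_apply, map_sub, map_smul, hti, smul_zero,
        sub_zero]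
    rw [← A.comp_sigma_mem_titsCone_iff (u := A.cs.simple i)]
    have hsplit : (l + μ) ∘ₗ A.sigma (A.cs.simple i) =
        (l + t • μ) + ((1 - t) • μ) ∘ₗ A.sigma (A.cs.simple i) := by
      rw [← hfix, ← LinearMap.add_comp]
      congr 1
      · module
    rw [hsplit]
    refine ih _ (hn ▸ hdesc) (A.cs.simple i * w) htD (fun k => ?_) rfl
    rw [LinearMap.comp_apply, ← sigma_mul_apply, A.cs.simple_mul_simple_cancel_left]
    exact mul_nonneg (by linarith) (hμ k)

theorem add_mem_titsCone {l μ : Module.Dual ℝ (ι → ℝ)} (hl : l ∈ A.titsCone)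
    (hμ : μ ∈ A.titsCone) : l + μ ∈ A.titsCone := by
  obtain ⟨u, hu⟩ := A.mem_titsCone_iff.mp hl
  obtain ⟨w, hw⟩ := A.mem_titsCone_iff.mp hμ
  rw [← A.comp_sigma_mem_titsCone_iff (u := u), LinearMap.add_comp]
  refine A.add_mem_titsCone_of_mem_fundamentalChamber (u⁻¹ * w) hu fun i => ?_
  rw [LinearMap.comp_apply, sigma_mul_apply, sigma_self_apply_inv]
  exact hw i

/-- The Tits cone as a pointed cone. -/
noncomputable def titsPointedCone : PointedCone ℝ (Module.Dual ℝ (ι → ℝ)) where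
  carrier := A.titsCone
  add_mem' := A.add_mem_titsCone
  zero_mem' := A.mem_titsCone_iff.mpr ⟨1, by simp⟩
  smul_mem' c l hl := by
    obtain ⟨w, hw⟩ := A.mem_titsCone_iff.mp hl
    exact A.mem_titsCone_iff.mpr ⟨w, fun i => mul_nonneg c.2 (hw i)⟩

/-! ### Finiteness of inversion sets and of `W` -/

/-- Up to positive multiples, only finitely many positive roots become negative under `f⁻¹`. -/
theorem exists_finite_inversions (f : A.W) :
    ∃ R : Set (ι → ℝ), R.Finite ∧ ∀ (x : A.W) (i : ι), 0 ≤ A.sigma x (simpleRoot i) →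
      A.sigma f⁻¹ (A.sigma x (simpleRoot i)) ≤ 0 →
      ∃ r ∈ R, ∃ c : ℝ, 0 < c ∧ A.sigma x (simpleRoot i) = c • r := by
  induction f using A.cs.simple_induction_left with
  | one =>
    refine ⟨∅, Set.finite_empty, fun x i h1 h2 => ?_⟩
    exact absurd (le_antisymm (by simpa using h2) h1) (A.sigma_simpleRoot_ne_zero x i)
  | mul_simple_left f j ih =>
    obtain ⟨R, hR, h⟩ := ih
    refine ⟨insert (simpleRoot j) (A.S j '' R), (hR.image _).insert _, fun x i h1 h2 => ?_⟩
    have hS : A.sigma (A.cs.simple j * x) (simpleRoot i) = A.S j (A.sigma x (simpleRoot i)) := by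
      rw [sigma_mul_apply, sigma_cs_simple]
    rcases A.sigma_simpleRoot_nonneg_or_nonpos (A.cs.simple j * x) i with hp | hp
    · rw [mul_inv_rev, A.cs.inv_simple, sigma_mul_apply, sigma_cs_simple, ← hS] at h2
      obtain ⟨r, hr, c, hc, he⟩ := h _ _ hp h2
      refine ⟨A.S j r, .inr ⟨r, hr, rfl⟩, c, hc, ?_⟩
      rw [← map_smul, ← he, hS, S_S]
    -- `s_j` changes only the `j`-th coordinate, so a positive root that it makes negative is a
    -- multiple of `α_j`.
    · refine ⟨simpleRoot j, .inl rfl, A.sigma x (simpleRoot i) j, ?_⟩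
      have hk : A.sigma x (simpleRoot i) = A.sigma x (simpleRoot i) j • simpleRoot j := by
        ext k
        by_cases hkj : k = j
        · subst hkj; simp [simpleRoot]
        · have := hp k
          rw [hS, S_apply] at this
          simp only [Pi.sub_apply, Pi.smul_apply, simpleRoot, Pi.single_apply, hkj, if_false,
            smul_zero, sub_zero, Pi.zero_apply] at this
          simp only [Pi.smul_apply, simpleRoot, Pi.single_apply, hkj, if_false, smul_zero]
          exact le_antisymm this (h1 k)
      refine ⟨lt_of_le_of_ne (h1 j) fun h0 => A.sigma_simpleRoot_ne_zero x i ?_, hk⟩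
      rw [hk, ← h0]
      simp

/-- If up to positive multiples there are only finitely many roots, then `W` is finite. -/
theorem finite_of_finite_rays {R : Set (ι → ℝ)} (hR : R.Finite)
    (h : ∀ (x : A.W) (i : ι), ∃ r ∈ R, ∃ c : ℝ, 0 < c ∧ A.sigma x (simpleRoot i) = c • r) :
    Finite A.W := by
  choose r hr c hc he using h
  have := hR.to_subtype
  refine Finite.of_injective (β := ι → R) (fun x i => ⟨r x i, hr x i⟩) fun x y hxy => ?_
  have hxy' : ∀ i, r x i = r y i := fun i => congrArg Subtype.val (congrFun hxy i)
  -- If `x` and `y` give the same rays, `y⁻¹x` sends each simple root to a positive multiple of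
  -- itself.
  have h1 : y⁻¹ * x = 1 := by
    refine A.eq_one_of_sigma_simpleRoot_nonneg fun i => ?_
    have h2 : A.sigma x (simpleRoot i) = (c x i / c y i) • A.sigma y (simpleRoot i) := by
      have := (hc y i).ne'
      rw [he x i, he y i, hxy' i, smul_smul]
      congr 1
      field_simp
    rw [sigma_mul_apply, h2, map_smul, sigma_inv_apply_self]
    exact smul_nonneg (div_pos (hc x i) (hc y i)).le (simpleRoot_nonneg i)
  exact (inv_mul_eq_one.mp h1).symm

/-- If every positive root becomes negative under one of finitely many elements, then `W` is
finite. -/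
theorem finite_of_forall_exists_inversion {F : Set A.W} (hF : F.Finite)
    (h : ∀ (x : A.W) (i : ι), 0 ≤ A.sigma x (simpleRoot i) →
      ∃ f ∈ F, A.sigma f⁻¹ (A.sigma x (simpleRoot i)) ≤ 0) : Finite A.W := by
  choose R hR hinv using A.exists_finite_inversions
  have hfin : (⋃ f ∈ F, R f).Finite := hF.biUnion fun f _ => hR f
  refine A.finite_of_finite_rays (hfin.union (hfin.image Neg.neg)) fun x i => ?_
  have key : ∀ (x : A.W) (i : ι), 0 ≤ A.sigma x (simpleRoot i) →
      ∃ r ∈ ⋃ f ∈ F, R f, ∃ c : ℝ, 0 < c ∧ A.sigma x (simpleRoot i) = c • r := by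
    intro x i hx
    obtain ⟨f, hf, hneg⟩ := h x i hx
    obtain ⟨r, hr, hc⟩ := hinv f x i hx hneg
    exact ⟨r, Set.mem_biUnion hf hr, hc⟩
  rcases A.sigma_simpleRoot_nonneg_or_nonpos x i with hx | hx
  · obtain ⟨r, hr, hc⟩ := key x i hx
    exact ⟨r, .inl hr, hc⟩
  · have hx' : A.sigma (x * A.cs.simple i) (simpleRoot i) = -A.sigma x (simpleRoot i) := by
      rw [sigma_mul_apply, sigma_cs_simple, S_simpleRoot_self, map_neg]
    obtain ⟨r, hr, c, hc, he⟩ := key (x * A.cs.simple i) i (by rw [hx']; exact neg_nonneg.mpr hx)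
    refine ⟨-r, .inr ⟨r, hr, rfl⟩, c, hc, ?_⟩
    rw [smul_neg, ← he, hx', neg_neg]

/-! ### The lineality space -/

/-- On a connected graph, an invariant subspace with one simple root contains all of them. -/
theorem simpleRoot_mem_of_connected (hconn : A.graph.Connected) {X : Submodule ℝ (ι → ℝ)}
    (hX : ∀ i, ∀ v ∈ X, A.S i v ∈ X) {i : ι} (hi : simpleRoot i ∈ X) (j : ι) :
    simpleRoot j ∈ X := by
  obtain ⟨p⟩ := hconn.preconnected i j
  induction p with
  | nil => exact hi
  | @cons u v _ hadj _ ih =>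
    apply ih
    have h1 := X.sub_mem hi (hX v _ hi)
    rw [S_simpleRoot, sub_sub_cancel] at h1
    exact (X.smul_mem_iff hadj.2.2).mp h1

theorem lineal_titsPointedCone (hconn : A.graph.Connected) (hW : Infinite A.W) :
    A.titsPointedCone.lineal = ⊥ := by
  by_contra hne
  set L := A.titsPointedCone.lineal with hL
  have hLsub : ∀ l ∈ L, ∀ u : A.W, l ∘ₗ A.sigma u ∈ L := by
    rintro l ⟨h1, h2⟩ u
    exact ⟨A.comp_sigma_mem_titsCone h1 u, A.comp_sigma_mem_titsCone h2 u⟩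
  have hroot : ∀ (x : A.W) (i : ι), ∃ l ∈ L, l (A.sigma x (simpleRoot i)) ≠ 0 := by
    intro x i
    by_contra! hx
    apply hne
    -- The common kernel of `L` is `W`-stable, so a root in it brings a simple root along.
    set X : Submodule ℝ (ι → ℝ) := L.dualCoannihilator with hXdef
    have hmem : ∀ v, v ∈ X ↔ ∀ l ∈ L, l v = 0 := fun v => Submodule.mem_dualCoannihilator _
    have hi : simpleRoot i ∈ X := by
      rw [hmem]
      intro l hl
      have := hx _ (hLsub l hl x⁻¹)
      rwa [LinearMap.comp_apply, sigma_inv_apply_self] at this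
    have hall := A.simpleRoot_mem_of_connected hconn (X := X) (fun j v hv => by
      rw [hmem] at hv ⊢
      intro l hl
      have := hv _ (hLsub l hl (A.cs.simple j))
      rwa [LinearMap.comp_apply, sigma_cs_simple] at this) hi
    rw [Submodule.eq_bot_iff]
    intro l hl
    ext j
    simpa [simpleRoot] using (hmem _).mp (hall j) l hl
  obtain ⟨G, hG⟩ : L.FG := IsNoetherian.noetherian L
  have hGL : ∀ g ∈ G, g ∈ A.titsCone ∧ -g ∈ A.titsCone := fun g hg => by
    have : g ∈ L := hG ▸ Submodule.subset_span hg
    exact this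
  -- Stated for all `g`, with dummy value `1` off `G`, so that `choose` gives functions of `g`
  -- alone.
  have hch : ∀ g : Module.Dual ℝ (ι → ℝ), ∃ u w : A.W, g ∈ G →
      (∀ i, 0 ≤ g (A.sigma u (simpleRoot i))) ∧ ∀ i, 0 ≤ (-g) (A.sigma w (simpleRoot i)) := by
    intro g
    by_cases hg : g ∈ G
    · obtain ⟨u, hu⟩ := A.mem_titsCone_iff.mp (hGL g hg).1
      obtain ⟨w, hw⟩ := A.mem_titsCone_iff.mp (hGL g hg).2
      exact ⟨u, w, fun _ => ⟨hu, hw⟩⟩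
    · exact ⟨1, 1, fun h => absurd h hg⟩
  choose u w huw using hch
  refine hW.not_finite ?_
  refine A.finite_of_forall_exists_inversion (F := u '' G ∪ w '' G)
    ((G.finite_toSet.image _).union (G.finite_toSet.image _)) fun x i hx => ?_
  by_contra! hF
  have hpos : ∀ f ∈ u '' (G : Set _) ∪ w '' (G : Set _),
      0 ≤ A.sigma f⁻¹ (A.sigma x (simpleRoot i)) := by
    intro f hf
    rw [← sigma_mul_apply]
    refine (A.sigma_simpleRoot_nonneg_or_nonpos _ _).resolve_right ?_
    rw [sigma_mul_apply]
    exact hF f hf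
  -- The root is positive as seen from both the chamber of `g` and that of `-g`.
  have hzero : ∀ g ∈ G, g (A.sigma x (simpleRoot i)) = 0 := by
    intro g hg
    obtain ⟨h1, h2⟩ := huw g hg
    have h3 := apply_nonneg_of_mem_fundamentalChamber (l := g ∘ₗ A.sigma (u g)) h1
      (hpos _ (.inl ⟨g, hg, rfl⟩))
    have h4 := apply_nonneg_of_mem_fundamentalChamber (l := (-g) ∘ₗ A.sigma (w g)) h2
      (hpos _ (.inr ⟨g, hg, rfl⟩))
    rw [LinearMap.comp_apply, sigma_self_apply_inv] at h3 h4
    rw [LinearMap.neg_apply] at h4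
    linarith
  obtain ⟨l, hl, hl0⟩ := hroot x i
  refine hl0 ?_
  clear hl0
  rw [← hG] at hl
  induction hl using Submodule.span_induction with
  | mem g hg => exact hzero g hg
  | zero => simp
  | add a b _ _ ha hb => rw [LinearMap.add_apply, ha, hb, add_zero]
  | smul c a _ ha => rw [LinearMap.smul_apply, ha, smul_zero]

end EGCM

theorem proposition4p3 {ι : Type*} [Fintype ι] [DecidableEq ι] (A : EGCM ι)
    (hconn : A.graph.Connected) (hcyc : A.UnitalONCyclic) (hW : Infinite A.W) :
    ∃ U : PointedCone ℝ (Module.Dual ℝ (ι → ℝ)),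
      (U : Set (Module.Dual ℝ (ι → ℝ))) = A.titsCone ∧
      U.lineal = ⊥ ∧
      A.titsCone ∩ -A.titsCone = {0} := by
  have hlin := A.lineal_titsPointedCone hconn hW
  refine ⟨A.titsPointedCone, rfl, hlin, ?_⟩
  change (A.titsPointedCone.lineal : Set (Module.Dual ℝ (ι → ℝ))) = {0}
  rw [hlin, Submodule.bot_coe]
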